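/- Here a ring is an associative ring that need not have a unit, and homomorphisms preserve addition and multiplication. Let $\mathcal{C}$ be either the category of all rings or the category of all commutative rings. Let $\mathcal{X}$ be a subvariety of $\mathcal{C}$, that is, the full subcategory of those objects of $\mathcal{C}$ that satisfy every identity in some set $\Phi$ of identities $s=t$ between terms in the operations $0,-,+,\cdot$. Suppose that the reflection of $\mathcal{C}$ onto $\mathcal{X}$ is a localization, that is, the left adjoint $F:\mathcal{C}\to\mathcal{X}$ of the inclusion functor $\mathcal{X}\to\mathcal{C}$ preserves all finite limits. Then the reflection is trivial: either $\mathcal{X}=\mathcal{C}$, or $\mathcal{X}$ consists precisely of the zero rings. -/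

import Mathlib

universe u

open CategoryTheory CategoryTheory.Limits

/-- The category of associative rings that need not have a unit. -/
structure RngCat where
  of ::
  /-- The underlying type. -/
  carrier : Type u
  [nonUnitalRing : NonUnitalRing carrier]

attribute [instance] RngCat.nonUnitalRing

namespace RngCat

instance : CoeSort RngCat.{u} (Type u) := ⟨RngCat.carrier⟩

/-- Morphisms are all maps preserving addition and multiplication. -/
@[ext]
structure Hom (A B : RngCat.{u}) where
  /-- The underlying homomorphism. -/
  hom' : A →ₙ+* B

instance : Category RngCat.{u} where
  Hom A B := Hom A B
  id A := ⟨NonUnitalRingHom.id A⟩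
  comp f g := ⟨g.hom'.comp f.hom'⟩

instance : ConcreteCategory.{u} RngCat.{u} (fun A B => A →ₙ+* B) where
  hom := Hom.hom'
  ofHom f := ⟨f⟩

end RngCat

/-- The category of commutative associative rings that need not have a unit. -/
structure CommRngCat where
  of ::
  /-- The underlying type. -/
  carrier : Type u
  [nonUnitalCommRing : NonUnitalCommRing carrier]

attribute [instance] CommRngCat.nonUnitalCommRing

namespace CommRngCat

instance : CoeSort CommRngCat.{u} (Type u) := ⟨CommRngCat.carrier⟩

/-- Morphisms are all maps preserving addition and multiplication. -/
@[ext]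
structure Hom (A B : CommRngCat.{u}) where
  /-- The underlying homomorphism. -/
  hom' : A →ₙ+* B

instance : Category CommRngCat.{u} where
  Hom A B := Hom A B
  id A := ⟨NonUnitalRingHom.id A⟩
  comp f g := ⟨g.hom'.comp f.hom'⟩

instance : ConcreteCategory.{u} CommRngCat.{u} (fun A B => A →ₙ+* B) where
  hom := Hom.hom'
  ofHom f := ⟨f⟩

end CommRngCat

/-- Terms in the operations `0, -, +, *` of non-unital rings, with variables indexed by `ℕ`. -/
inductive RngTerm : Type
  | var (n : ℕ) : RngTerm
  | zero : RngTerm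
  | neg (s : RngTerm) : RngTerm
  | add (s t : RngTerm) : RngTerm
  | mul (s t : RngTerm) : RngTerm

namespace RngTerm

/-- The value of a term in a ring under an assignment of the variables. -/
def eval {A : Type u} [NonUnitalRing A] (v : ℕ → A) : RngTerm → A
  | var n => v n
  | zero => 0
  | neg s => -(eval v s)
  | add s t => eval v s + eval v t
  | mul s t => eval v s * eval v t

end RngTerm

/-- The ring `A` satisfies every identity `s = t` with `(s, t) ∈ Φ`. -/
def SatisfiesIdentities (A : Type u) [NonUnitalRing A] (Φ : Set (RngTerm × RngTerm)) : Prop :=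
  ∀ p ∈ Φ, ∀ v : ℕ → A, p.1.eval v = p.2.eval v

/-- The subvariety of the variety of rings determined by the identities `Φ`. -/
def RngCat.subvariety (Φ : Set (RngTerm × RngTerm)) : ObjectProperty RngCat.{u} :=
  fun A => SatisfiesIdentities A Φ

/-- The subvariety of the variety of commutative rings determined by the identities `Φ`. -/
def CommRngCat.subvariety (Φ : Set (RngTerm × RngTerm)) : ObjectProperty CommRngCat.{u} :=
  fun A => SatisfiesIdentities A Φ

/-! Suppose an identity `s = t` of `Φ` fails in some ring. Let `R` be the free unital (commutative)
ring on countably many generators and `p = s - t` evaluated at them. Then `p` is nonzero and lies in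
the augmentation ideal of the domain `R`, so it is transcendental over `ℤ`, and `q ↦ q(p)` embeds
the free ring on one generator, `Xℤ[X]`, into `R` (`substitute_injective`). The reflection of `R`
satisfies `s = t`, so the unit kills `p` and hence this subring. As `F` preserves monomorphisms,
every map from `Xℤ[X]` to an object of the subvariety is zero (`eq_zero_of_comp_unit_eq_zero`). Such
maps pick out arbitrary elements, so the object is zero. -/

open Polynomial in
/-- The ring of integer polynomials without constant term: the free ring on one generator. -/
def intPolynomialZeroConst : NonUnitalSubring ℤ[X] where
  carrier := {q | q.coeff 0 = 0}
  zero_mem' := by simp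
  add_mem' := by
    intro a b ha hb
    simp_all
  neg_mem' := by
    intro a ha
    simp_all
  mul_mem' := by
    intro a b ha hb
    simp_all [mul_coeff_zero]

namespace intPolynomialZeroConst

open Polynomial

theorem mem_iff {q : ℤ[X]} : q ∈ intPolynomialZeroConst ↔ q.coeff 0 = 0 := Iff.rfl

theorem fst_aeval_inr {A : Type u} [NonUnitalRing A] (a : A) (q : ℤ[X]) :
    (aeval (Unitization.inr a : Unitization ℤ A) q).fst = q.coeff 0 := by
  have h : (aeval (Unitization.inr a : Unitization ℤ A) q).fst =
      Unitization.fstHom ℤ A (aeval (Unitization.inr a : Unitization ℤ A) q) := rfl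
  rw [h, ← aeval_algHom_apply]
  simp [coeff_zero_eq_aeval_zero]

/-- The homomorphism that substitutes `a` for the variable. -/
noncomputable def lift {A : Type u} [NonUnitalRing A] (a : A) : intPolynomialZeroConst →ₙ+* A where
  toFun q := (aeval (Unitization.inr a : Unitization ℤ A) q.1).snd
  map_zero' := by simp
  map_add' p q := by simp
  map_mul' p q := by
    -- The mixed terms of a product in the unitization carry the constant coefficients as factors,
    -- which vanish.
    simp [fst_aeval_inr, mem_iff.1 p.2, mem_iff.1 q.2]

theorem lift_X {A : Type u} [NonUnitalRing A] (a : A) :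
    lift a ⟨X, mem_iff.2 coeff_X_zero⟩ = a := by
  change (aeval (Unitization.inr a : Unitization ℤ A) X).snd = a
  rw [aeval_X, Unitization.snd_inr]

/-- Substitution of an element of a unital ring for the variable. -/
noncomputable def substitute {R : Type u} [Ring R] (p : R) : ULift.{u} intPolynomialZeroConst →ₙ+* R where
  toFun q := aeval p q.down.1
  map_zero' := by simp
  map_add' p q := by simp
  map_mul' p q := by simp

/-- A nonzero element of an augmentation ideal of a domain is transcendental over the integers. -/
theorem aeval_ne_zero {R : Type u} [Ring R] [NoZeroDivisors R] (ε : R →ₐ[ℤ] ℤ) {p : R}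
    (hp : p ≠ 0) (hε : ε p = 0) {q : ℤ[X]} (hq : q ≠ 0) : aeval p q ≠ 0 := by
  -- Write `q = X ^ n * r` with `r(0) ≠ 0`. Since `ε (r(p)) = r(0)`, neither factor of `q(p)`
  -- vanishes.
  obtain ⟨r, hr, hX⟩ := exists_eq_pow_rootMultiplicity_mul_and_not_dvd q hq 0
  rw [C_0, sub_zero] at hr hX
  have : Nontrivial R := ⟨p, 0, hp⟩
  rw [hr, map_mul, map_pow, aeval_X]
  refine mul_ne_zero (pow_ne_zero _ hp) fun h => hX ?_
  have h' := congrArg ε h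
  rw [← aeval_algHom_apply, hε, map_zero] at h'
  rwa [X_dvd_iff, coeff_zero_eq_aeval_zero]

theorem substitute_injective {R : Type u} [Ring R] [NoZeroDivisors R] (ε : R →ₐ[ℤ] ℤ) {p : R}
    (hp : p ≠ 0) (hε : ε p = 0) : Function.Injective (substitute p) := by
  rw [injective_iff_map_eq_zero]
  intro q hq
  by_contra h
  refine aeval_ne_zero ε hp hε (q := q.down.1) (fun h' => h ?_) hq
  exact ULift.ext _ _ (Subtype.ext h')

/-- A homomorphism that kills `p` kills all polynomials in `p` without constant term. -/
theorem map_substitute_eq_zero {R B : Type u} [Ring R] [NonUnitalRing B] (g : R →ₙ+* B) {p : R}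
    (h : g p = 0) (q : ULift.{u} intPolynomialZeroConst) : g (substitute p q) = 0 := by
  obtain ⟨r, hr⟩ := X_dvd_iff.2 (mem_iff.1 q.down.2)
  change g (aeval p q.down.1) = 0
  rw [hr, map_mul, aeval_X, map_mul, h, zero_mul]

end intPolynomialZeroConst

theorem RngTerm.map_eval {A B : Type u} [NonUnitalRing A] [NonUnitalRing B] (g : A →ₙ+* B)
    (v : ℕ → A) (s : RngTerm) : g (s.eval v) = s.eval fun n => g (v n) := by
  induction s <;> simp_all [RngTerm.eval]

/-- If some ring violates an identity of `Φ`, then the difference of the sides of this identity,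
at the generators of a unital algebra with the universal property for homomorphisms into the
unitization of the ring, is nonzero. -/
theorem RngTerm.eval_sub_eval_ne_zero {A R : Type u} [NonUnitalRing A] [Ring R]
    (x : ℕ → R) (v : ℕ → A) (g : R →ₐ[ℤ] Unitization ℤ A) (hg : ∀ n, g (x n) = Unitization.inr (v n))
    {s t : RngTerm} (h : s.eval v ≠ t.eval v) : s.eval x - t.eval x ≠ 0 := by
  intro h0
  have key (s : RngTerm) : g (s.eval x) = Unitization.inr (s.eval v) := by
    induction s <;> simp_all [RngTerm.eval]
  apply h
  apply Unitization.inr_injective (R := ℤ)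
  rw [← key, ← key, sub_eq_zero.1 h0]

/-- Terms involve no constant other than `0`, so their values stay in the augmentation ideal. -/
theorem RngTerm.augmentation_eval_sub_eval {R : Type u} [Ring R] (x : ℕ → R) (ε : R →ₐ[ℤ] ℤ)
    (hε : ∀ n, ε (x n) = 0) (s t : RngTerm) : ε (s.eval x - t.eval x) = 0 := by
  have key (s : RngTerm) : ε (s.eval x) = 0 := by
    induction s <;> simp_all [RngTerm.eval]
  simp [key]

theorem SatisfiesIdentities.of_subsingleton (A : Type u) [NonUnitalRing A] [Subsingleton A]
    (Φ : Set (RngTerm × RngTerm)) : SatisfiesIdentities A Φ :=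
  fun _ _ _ => Subsingleton.elim _ _

/-- Used with `g` the unit of the reflection. -/
theorem SatisfiesIdentities.map_eval_sub_eval {A R : Type u} [NonUnitalRing A] [NonUnitalRing R]
    {Φ : Set (RngTerm × RngTerm)} (hA : SatisfiesIdentities A Φ) (g : R →ₙ+* A) (x : ℕ → R)
    {p : RngTerm × RngTerm} (hp : p ∈ Φ) : g (p.1.eval x - p.2.eval x) = 0 := by
  rw [map_sub, RngTerm.map_eval, RngTerm.map_eval, hA p hp, sub_self]

/-- If a reflector preserves the monomorphism `f` and the unit vanishes on `f`, then all morphisms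
from the domain of `f` to reflected objects vanish. -/
theorem CategoryTheory.Adjunction.eq_zero_of_comp_unit_eq_zero {C D : Type*} [Category* C]
    [Category* D] [HasZeroMorphisms C] {F : C ⥤ D} {G : D ⥤ C} (adj : F ⊣ G)
    [F.PreservesMonomorphisms] {B R : C} (f : B ⟶ R) [Mono f] (h : f ≫ adj.unit.app R = 0)
    {Y : D} (u : B ⟶ G.obj Y) : u = 0 := by
  -- `D` carries no zero morphisms, so the transpose of `0` stands in for one. Composed with `F.map
  -- f` it agrees with the identity, because the transpose of `F.map f` is `f ≫ adj.unit.app R = 0`.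
  have hid : (adj.homEquiv B (F.obj B)).symm 0 = 𝟙 (F.obj B) := by
    rw [← cancel_mono (F.map f)]
    apply (adj.homEquiv _ _).injective
    rw [adj.homEquiv_naturality_right, Equiv.apply_symm_apply, zero_comp, Category.id_comp,
      adj.homEquiv_unit, adj.unit_naturality, h]
  have hunit : adj.unit.app B = 0 := by
    rw [← adj.homEquiv_id, ← hid, Equiv.apply_symm_apply]
  rw [← (adj.homEquiv B Y).apply_symm_apply u, adj.homEquiv_unit, hunit, zero_comp]

instance : HasZeroMorphisms RngCat.{u} where
  zero _ _ := ⟨⟨0⟩⟩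
  comp_zero _ _ := rfl
  zero_comp _ _ _ g := RngCat.Hom.ext (NonUnitalRingHom.ext fun _ => map_zero g.hom')

instance : HasZeroMorphisms CommRngCat.{u} where
  zero _ _ := ⟨⟨0⟩⟩
  comp_zero _ _ := rfl
  zero_comp _ _ _ g := CommRngCat.Hom.ext (NonUnitalRingHom.ext fun _ => map_zero g.hom')

theorem RngCat.mono_of_injective {A B : RngCat.{u}} (f : A ⟶ B)
    (hf : Function.Injective f.hom') : Mono f where
  right_cancellation _ _ h := RngCat.Hom.ext <| NonUnitalRingHom.ext fun z =>
    hf (DFunLike.congr_fun (congrArg RngCat.Hom.hom' h) z)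

theorem CommRngCat.mono_of_injective {A B : CommRngCat.{u}} (f : A ⟶ B)
    (hf : Function.Injective f.hom') : Mono f where
  right_cancellation _ _ h := CommRngCat.Hom.ext <| NonUnitalRingHom.ext fun z =>
    hf (DFunLike.congr_fun (congrArg CommRngCat.Hom.hom' h) z)

/-- A localization of the variety of rings onto a subvariety is trivial. -/
theorem RngCat.subvariety_trivial (Φ : Set (RngTerm × RngTerm))
    (F : RngCat.{u} ⥤ (RngCat.subvariety.{u} Φ).FullSubcategory)
    (adj : F ⊣ (RngCat.subvariety.{u} Φ).ι) [PreservesFiniteLimits F] :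
    (∀ A : RngCat.{u}, RngCat.subvariety Φ A) ∨
      (∀ A : RngCat.{u}, RngCat.subvariety Φ A ↔ Subsingleton A) := by
  refine or_iff_not_imp_left.2 fun hΦ A =>
    ⟨fun hA => ?_, fun _ => SatisfiesIdentities.of_subsingleton A Φ⟩
  simp only [RngCat.subvariety, SatisfiesIdentities, not_forall] at hΦ
  obtain ⟨A₀, p, hp, v, hv⟩ := hΦ
  let R := FreeAlgebra ℤ (ULift.{u} ℕ)
  let x : ℕ → R := fun n => FreeAlgebra.ι ℤ ⟨n⟩
  have hne := RngTerm.eval_sub_eval_ne_zero x v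
    (FreeAlgebra.lift ℤ fun n : ULift ℕ => (Unitization.inr (v n.down) : Unitization ℤ A₀))
    (fun n => FreeAlgebra.lift_ι_apply _ _) hv
  have hε := RngTerm.augmentation_eval_sub_eval x
    (FreeAlgebra.lift ℤ fun _ : ULift ℕ => (0 : ℤ)) (fun n => FreeAlgebra.lift_ι_apply _ _) p.1 p.2
  let f : RngCat.of (ULift.{u} intPolynomialZeroConst) ⟶ RngCat.of R :=
    ⟨intPolynomialZeroConst.substitute (p.1.eval x - p.2.eval x)⟩
  have : Mono f := RngCat.mono_of_injective f
    (intPolynomialZeroConst.substitute_injective _ hne hε)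
  have hf : f ≫ adj.unit.app (RngCat.of R) = 0 :=
    RngCat.Hom.ext <| NonUnitalRingHom.ext <|
      intPolynomialZeroConst.map_substitute_eq_zero (R := R)
        (adj.unit.app (RngCat.of R)).hom'
        ((F.obj (RngCat.of R)).property.map_eval_sub_eval _ x hp)
  refine subsingleton_of_forall_eq 0 fun a => ?_
  -- This map sends `X` to `a`, so its vanishing gives `a = 0`.
  let u : RngCat.of (ULift.{u} intPolynomialZeroConst) ⟶
      (RngCat.subvariety.{u} Φ).ι.obj ⟨A, hA⟩ :=
    ⟨(intPolynomialZeroConst.lift a).comp (ULift.ringEquiv : _ ≃+* _).toNonUnitalRingHom⟩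
  have hu := adj.eq_zero_of_comp_unit_eq_zero f hf u
  rw [← intPolynomialZeroConst.lift_X a]
  exact DFunLike.congr_fun (congrArg RngCat.Hom.hom' hu) ⟨_⟩

/-- A localization of the variety of commutative rings onto a subvariety is trivial. -/
theorem CommRngCat.subvariety_trivial (Φ : Set (RngTerm × RngTerm))
    (F : CommRngCat.{u} ⥤ (CommRngCat.subvariety.{u} Φ).FullSubcategory)
    (adj : F ⊣ (CommRngCat.subvariety.{u} Φ).ι) [PreservesFiniteLimits F] :
    (∀ A : CommRngCat.{u}, CommRngCat.subvariety Φ A) ∨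
      (∀ A : CommRngCat.{u}, CommRngCat.subvariety Φ A ↔ Subsingleton A) := by
  refine or_iff_not_imp_left.2 fun hΦ A =>
    ⟨fun hA => ?_, fun _ => SatisfiesIdentities.of_subsingleton A Φ⟩
  simp only [CommRngCat.subvariety, SatisfiesIdentities, not_forall] at hΦ
  obtain ⟨A₀, p, hp, v, hv⟩ := hΦ
  -- Integer polynomials replace the free algebra: again a domain with an augmentation, now
  -- universal for commutative targets.
  let R := MvPolynomial (ULift.{u} ℕ) ℤ
  let x : ℕ → R := fun n => MvPolynomial.X ⟨n⟩
  have hne := RngTerm.eval_sub_eval_ne_zero x v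
    (MvPolynomial.aeval fun n : ULift ℕ => (Unitization.inr (v n.down) : Unitization ℤ A₀))
    (fun n => MvPolynomial.aeval_X _ _) hv
  have hε := RngTerm.augmentation_eval_sub_eval x
    (MvPolynomial.aeval fun _ : ULift ℕ => (0 : ℤ)) (fun n => MvPolynomial.aeval_X _ _) p.1 p.2
  let f : CommRngCat.of (ULift.{u} intPolynomialZeroConst) ⟶ CommRngCat.of R :=
    ⟨intPolynomialZeroConst.substitute (p.1.eval x - p.2.eval x)⟩
  have : Mono f := CommRngCat.mono_of_injective f
    (intPolynomialZeroConst.substitute_injective _ hne hε)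
  have hf : f ≫ adj.unit.app (CommRngCat.of R) = 0 :=
    CommRngCat.Hom.ext <| NonUnitalRingHom.ext <|
      intPolynomialZeroConst.map_substitute_eq_zero (R := R)
        (adj.unit.app (CommRngCat.of R)).hom'
        ((F.obj (CommRngCat.of R)).property.map_eval_sub_eval _ x hp)
  refine subsingleton_of_forall_eq 0 fun a => ?_
  let u : CommRngCat.of (ULift.{u} intPolynomialZeroConst) ⟶
      (CommRngCat.subvariety.{u} Φ).ι.obj ⟨A, hA⟩ :=
    ⟨(intPolynomialZeroConst.lift a).comp (ULift.ringEquiv : _ ≃+* _).toNonUnitalRingHom⟩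
  have hu := adj.eq_zero_of_comp_unit_eq_zero f hf u
  rw [← intPolynomialZeroConst.lift_X a]
  exact DFunLike.congr_fun (congrArg CommRngCat.Hom.hom' hu) ⟨_⟩

theorem mainTheorem9 :
    (∀ (Φ : Set (RngTerm × RngTerm))
        (F : RngCat.{u} ⥤ (RngCat.subvariety.{u} Φ).FullSubcategory)
        (_ : F ⊣ (RngCat.subvariety.{u} Φ).ι) (_ : PreservesFiniteLimits F),
      (∀ A : RngCat.{u}, RngCat.subvariety Φ A) ∨
        (∀ A : RngCat.{u}, RngCat.subvariety Φ A ↔ Subsingleton A)) ∧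
    (∀ (Φ : Set (RngTerm × RngTerm))
        (F : CommRngCat.{u} ⥤ (CommRngCat.subvariety.{u} Φ).FullSubcategory)
        (_ : F ⊣ (CommRngCat.subvariety.{u} Φ).ι) (_ : PreservesFiniteLimits F),
      (∀ A : CommRngCat.{u}, CommRngCat.subvariety Φ A) ∨
        (∀ A : CommRngCat.{u}, CommRngCat.subvariety Φ A ↔ Subsingleton A)) :=
  ⟨fun Φ F adj _ => RngCat.subvariety_trivial Φ F adj,
    fun Φ F adj _ => CommRngCat.subvariety_trivial Φ F adj⟩
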